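/- Write points of $\mathbb{R}^{1+3}$ as $X=(\tau,\xi)$ with $\tau\in\mathbb{R}$, $\xi\in\mathbb{R}^3$, and let $\widehat u(X)=\int_{\mathbb{R}^{1+3}} e^{-ix\cdot X}u(x)\,dx$ denote the Fourier transform on $\mathbb{R}^{1+3}$ (extended to $L^2$ in the usual way), $\|\cdot\|$ the norm of $L^2(\mathbb{R}^{1+3})$. For a sign $\pm$ and $N,L>0$ let $$K^{\pm}_{N,L}=\bigl\{(\tau,\xi)\in\mathbb{R}^{1+3} : N/2<|\xi|\le N,\ \bigl|-\tau\pm|\xi|\bigr|\le L\bigr\}.$$ For measurable $A\subset\mathbb{R}^{1+3}$ let $\mathbf P_A$ be the Fourier multiplier given by $\widehat{\mathbf P_A u}=\chi_A\widehat u$. Given signs $\pm_1,\pm_2$, let $\theta_{12}=\theta(\pm_1\xi_1,\pm_2\xi_2)\in[0,\pi]$ be the angle between the nonzero vectors $\pm_1\xi_1,\pm_2\xi_2\in\mathbb{R}^3$, and let $\mathfrak B_{\sqrt{\theta_{12}}}(u_1,u_2)$ be the bilinear operator defined by $$\mathcal F\bigl(\mathfrak B_{\sqrt{\theta_{12}}}(u_1,u_2)\bigr)(X_0)=\iint\sqrt{\theta_{12}}\;\widehat{u_1}(X_1)\,\widehat{u_2}(X_2)\,\delta(X_0-X_1-X_2)\,dX_1\,dX_2,\qquad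 X_j=(\tau_j,\xi_j).$$ **Theorem.** There is an absolute constant $C>0$ such that the following holds. Let $\pm_1,\pm_2$ be arbitrary signs, let $N_1,N_2,L_1,L_2,r>0$, and let $B\subset\mathbb{R}^3$ be a ball of radius $r$ with arbitrary centre. If $u_1,u_2\in L^2(\mathbb{R}^{1+3})$ satisfy $\operatorname{supp}\widehat{u_j}\subset K^{\pm_j}_{N_j,L_j}$ for $j=1,2$ (that is, $\widehat{u_j}=0$ almost everywhere outside $K^{\pm_j}_{N_j,L_j}$), then $\mathfrak B_{\sqrt{\theta_{12}}}(\mathbf P_{\mathbb{R}\times B}u_1,u_2)$ belongs to $L^2(\mathbb{R}^{1+3})$ and $$\bigl\|\mathfrak B_{\sqrt{\theta_{12}}}(\mathbf P_{\mathbb{R}\times B}u_1,u_2)\bigr\|\le C\,(r^2L_1L_2)^{1/2}\,\|u_1\|\,\|u_2\|.$$ -/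

import Mathlib

open MeasureTheory FourierTransform
open scoped ENNReal

noncomputable section

/-- `ℝ³` with the Euclidean norm. -/
abbrev Space : Type := EuclideanSpace ℝ (Fin 3)

/-- `ℝ^{1+3}` with the Euclidean structure (its volume is `dt dx`): the points `X = (τ, ξ)`
have time component `X.fst` and space component `X.snd`. -/
abbrev Spacetime : Type := WithLp 2 (ℝ × Space)

/-- Complex valued `L²(ℝ^{1+3})`. -/
abbrev L2Spacetime : Type := Lp (α := Spacetime) ℂ 2 volume

/-- A representative of the Fourier transform of `u ∈ L²(ℝ^{1+3})` in the normalization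
`û(X) = ∫ e^{-i x · X} u(x) dx`. Mathlib's `𝓕` (defined on `L²` by density) uses the kernel
`e^{-2 π i x · X}`, hence the rescaling. -/
def hat (u : L2Spacetime) (X : Spacetime) : ℂ :=
  (𝓕 u : L2Spacetime) ((2 * Real.pi)⁻¹ • X)

/-- The points whose dilate by `2π` is in `A`: the set `A` in the frequency variable of `𝓕`. -/
def rescaled (A : Set Spacetime) : Set Spacetime := {Y | (2 * Real.pi) • Y ∈ A}

theorem measurableSet_rescaled {A : Set Spacetime} (hA : MeasurableSet A) :
    MeasurableSet (rescaled A) :=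
  (measurable_const_smul (2 * Real.pi)) hA

/-- The Fourier multiplier `P_A` on `L²(ℝ^{1+3})` whose symbol is the indicator function of `A`. -/
def fourierRestrict (A : Set Spacetime) (hA : MeasurableSet A) (u : L2Spacetime) : L2Spacetime :=
  𝓕⁻ (((Lp.memLp (𝓕 u : L2Spacetime)).indicator (measurableSet_rescaled hA)).toLp
    ((rescaled A).indicator (𝓕 u : L2Spacetime)) : L2Spacetime)

theorem ae_dilate {p : Spacetime → Prop} (h : ∀ᵐ Y, p Y) {c : ℝ} (hc : c ≠ 0) :
    ∀ᵐ X, p (c • X) := by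
  have : Filter.Tendsto (fun X : Spacetime => c • X) (ae volume) (ae volume) := by
    apply Measure.QuasiMeasurePreserving.tendsto_ae
    refine ⟨measurable_const_smul c, ?_⟩
    rw [Measure.map_addHaar_smul _ hc]
    exact Measure.smul_absolutelyContinuous
  exact this.eventually h

/-- The defining property of `P_A`: the Fourier transform of `P_A u` is `χ_A û`. -/
theorem hat_fourierRestrict (A : Set Spacetime) (hA : MeasurableSet A) (u : L2Spacetime) :
    ∀ᵐ X, hat (fourierRestrict A hA u) X = A.indicator (hat u) X := by
  have h : ∀ᵐ Y, (𝓕 (fourierRestrict A hA u) : L2Spacetime) Y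
      = (rescaled A).indicator (𝓕 u : L2Spacetime) Y := by
    rw [fourierRestrict, fourier_fourierInv_eq]
    exact MemLp.coeFn_toLp _
  have hpi : (2 * Real.pi) ≠ 0 := by positivity
  filter_upwards [ae_dilate h (inv_ne_zero hpi)] with X hX
  have hmem : (2 * Real.pi)⁻¹ • X ∈ rescaled A ↔ X ∈ A := by
    change (2 * Real.pi) • ((2 * Real.pi)⁻¹ • X) ∈ A ↔ X ∈ A
    rw [smul_inv_smul₀ hpi]
  unfold hat
  rw [hX]
  by_cases hXA : X ∈ A
  · rw [Set.indicator_of_mem (hmem.2 hXA), Set.indicator_of_mem hXA]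
  · rw [Set.indicator_of_notMem (fun h' => hXA (hmem.1 h')), Set.indicator_of_notMem hXA]

/-- An element of `L²(ℝ^{1+3})` is determined by its Fourier transform. -/
theorem hat_injective {u v : L2Spacetime} (h : ∀ᵐ X, hat u X = hat v X) : u = v := by
  have hpi : (2 * Real.pi) ≠ 0 := by positivity
  have h' : (𝓕 u : L2Spacetime) = 𝓕 v := by
    apply Lp.ext
    filter_upwards [ae_dilate h hpi] with X hX
    unfold hat at hX
    rwa [inv_smul_smul₀ hpi] at hX
  calc u = 𝓕⁻ (𝓕 u : L2Spacetime) := (fourierInv_fourier_eq u).symm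
    _ = v := by rw [h', fourierInv_fourier_eq]

/-- A sign `±` as a real number. -/
def sgn (s : ℤˣ) : ℝ := ((s : ℤ) : ℝ)

/-- The truncated thickened cone
`K^±_{N,L} = {(τ, ξ) : N/2 < |ξ| ≤ N, |-τ ± |ξ|| ≤ L}`. -/
def thickCone (s : ℤˣ) (N L : ℝ) : Set Spacetime :=
  {X | N / 2 < ‖X.snd‖ ∧ ‖X.snd‖ ≤ N ∧ |-X.fst + sgn s * ‖X.snd‖| ≤ L}

/-- `û` is supported in `A`, i.e. it vanishes almost everywhere outside `A`. -/
def FourierSupportedIn (u : L2Spacetime) (A : Set Spacetime) : Prop :=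
  ∀ᵐ X, X ∉ A → hat u X = 0

/-- The set `ℝ × B`, where `B` is the closed ball in `ℝ³` with centre `c` and radius `r`. -/
def ballCylinder (c : Space) (r : ℝ) : Set Spacetime := {X | X.snd ∈ Metric.closedBall c r}

theorem measurableSet_ballCylinder (c : Space) (r : ℝ) : MeasurableSet (ballCylinder c r) :=
  (Metric.isClosed_closedBall.preimage (WithLp.continuous_snd 2 ℝ Space)).measurableSet

/-- The angle `θ₁₂ = θ(±₁ξ₁, ±₂ξ₂) ∈ [0, π]`. -/
def theta (s₁ s₂ : ℤˣ) (ξ₁ ξ₂ : Space) : ℝ :=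
  InnerProductGeometry.angle (sgn s₁ • ξ₁) (sgn s₂ • ξ₂)

/-- `w ∈ L²(ℝ^{1+3})` is the value at `(u₁, u₂)` of the bilinear operator `𝔅_m` with symbol
`m(ξ₁, ξ₂)`: for almost every `X₀`,
`ŵ(X₀) = ∬ m(ξ₁, ξ₂) û₁(X₁) û₂(X₂) δ(X₀ - X₁ - X₂) dX₁ dX₂`, with an absolutely convergent
integral. By `hat_injective` there is at most one such `w`. -/
def IsBilinear (m : Space → Space → ℝ) (u₁ u₂ w : L2Spacetime) : Prop :=
  ∀ᵐ X₀ : Spacetime,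
    Integrable (fun X₁ : Spacetime =>
      (m X₁.snd (X₀ - X₁).snd : ℂ) * hat u₁ X₁ * hat u₂ (X₀ - X₁)) ∧
    hat w X₀ = ∫ X₁ : Spacetime,
      (m X₁.snd (X₀ - X₁).snd : ℂ) * hat u₁ X₁ * hat u₂ (X₀ - X₁)

end

/-! Cauchy-Schwarz in the convolution integral, with the square root of the angle as weight, reduces
the estimate to a bound, uniform in `X₀`, on the integral of θ₁₂ over `interactionSet`
(`exists_isBilinear`, `lintegral_theta_thickCone_le`). For fixed `ξ`, the time variable ranges over
a set of measure at most `2 * min L₁ L₂`, while `ξ` lies in the ball and in the shell where `phase`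
is within `L₁ + L₂` of `τ₀`. It remains to integrate θ₁₂ over this shell. The gradient of the phase
is the difference of the unit vectors in the directions `±₁ξ` and `±₂(ξ₀ - ξ)`, so θ₁₂ is at most
π/2 times its length: the weight is small exactly where the shell may be thick. Bounding the length
by the sum of the partial derivatives leaves a one-dimensional problem on coordinate lines. There
the derivative of the phase has the sign of an affine function, so its absolute value integrates
over the preimage of an interval to at most twice the interval's length. The transverse variables
contribute `(2r)²`. -/

/-! ### Variation of the phase along a line -/

theorem div_sqrt_add_sq_eq_sin_arctan {a : ℝ} (ha : 0 < a) (u : ℝ) :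
    u / √(a + u ^ 2) = Real.sin (Real.arctan (u / √a)) := by
  have h : 1 + (u / √a) ^ 2 = (a + u ^ 2) / a := by
    rw [div_pow, Real.sq_sqrt ha.le]; field_simp
  rw [Real.sin_arctan, h, Real.sqrt_div (by positivity)]
  have := Real.sqrt_pos.2 ha
  field_simp

/-- Both quotients are the same odd increasing function `sin ∘ arctan`, evaluated at `u / √a` and `v
/ √b`; hence the sum of the values inherits the sign of the sum of the arguments. The latter is
affine in `t` when `u` and `v` are. -/
theorem div_sqrt_add_div_sqrt_nonneg {a b u v : ℝ} (ha : 0 < a) (hb : 0 < b)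
    (h : 0 ≤ u / √a + v / √b) : 0 ≤ u / √(a + u ^ 2) + v / √(b + v ^ 2) := by
  have h1 : Real.arctan (-(v / √b)) ≤ Real.arctan (u / √a) :=
    Real.arctan_strictMono.monotone (by linarith)
  have h2 := Real.sin_le_sin_of_le_of_le_pi_div_two (Real.neg_pi_div_two_lt_arctan _).le
    (Real.arctan_lt_pi_div_two _).le h1
  rw [Real.arctan_neg, Real.sin_neg] at h2
  rw [div_sqrt_add_sq_eq_sin_arctan ha, div_sqrt_add_sq_eq_sin_arctan hb]
  linarith

/-- If the derivative of `f` has the sign of an affine function, then the total variation of `f`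
over the preimage of a measurable set is at most twice the measure of that set. -/
theorem lintegral_abs_deriv_preimage_le {f f' : ℝ → ℝ} (hf : ∀ t, HasDerivAt f (f' t) t)
    {α β : ℝ} (hpos : ∀ t, 0 ≤ α * t + β → 0 ≤ f' t) (hneg : ∀ t, α * t + β ≤ 0 → f' t ≤ 0)
    {I : Set ℝ} (hI : MeasurableSet I) :
    ∫⁻ t in f ⁻¹' I, ENNReal.ofReal |f' t| ≤ 2 * volume I := by
  have hfc : Continuous f := continuous_iff_continuousAt.2 fun t => (hf t).continuousAt
  have hd : deriv f = f' := funext fun t => (hf t).deriv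
  have hcv : Continuous fun t : ℝ => α * t + β := by fun_prop
  have hmp : MeasurableSet {t : ℝ | 0 ≤ α * t + β} := (isClosed_le continuous_const hcv).measurableSet
  have hmn : MeasurableSet {t : ℝ | α * t + β ≤ 0} := (isClosed_le hcv continuous_const).measurableSet
  have hcp : Convex ℝ {t : ℝ | 0 ≤ α * t + β} := by
    intro x hx y hy u v hu hv huv
    simp only [Set.mem_ofPred_eq, smul_eq_mul] at *
    have : α * (u * x + v * y) + β = u * (α * x + β) + v * (α * y + β) := by
      linear_combination (-β) * huv
    rw [this]; positivity
  have hcn : Convex ℝ {t : ℝ | α * t + β ≤ 0} := by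
    intro x hx y hy u v hu hv huv
    simp only [Set.mem_ofPred_eq, smul_eq_mul] at *
    have : α * (u * x + v * y) + β = u * (α * x + β) + v * (α * y + β) := by
      linear_combination (-β) * huv
    rw [this]
    have := mul_nonneg hu (neg_nonneg.2 hx)
    have := mul_nonneg hv (neg_nonneg.2 hy)
    linarith
  have mono : MonotoneOn f {t | 0 ≤ α * t + β} :=
    monotoneOn_of_deriv_nonneg hcp hfc.continuousOn
      (fun t _ => (hf t).differentiableAt.differentiableWithinAt)
      (fun t ht => by
        have ht' : t ∈ {t | 0 ≤ α * t + β} := interior_subset ht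
        rw [hd]; exact hpos t ht')
  have anti : AntitoneOn f {t | α * t + β ≤ 0} :=
    antitoneOn_of_deriv_nonpos hcn hfc.continuousOn
      (fun t _ => (hf t).differentiableAt.differentiableWithinAt)
      (fun t ht => by
        have ht' : t ∈ {t | α * t + β ≤ 0} := interior_subset ht
        rw [hd]; exact hneg t ht')
  have hIm : MeasurableSet (f ⁻¹' I) := hfc.measurable hI
  -- On each of the two convex pieces `f` is monotone, so the integral of `|f'|` is the measure of
  -- an image, and that image lies in `I`.
  have h1 : ∫⁻ t in {t | 0 ≤ α * t + β} ∩ f ⁻¹' I, ENNReal.ofReal |f' t| ≤ volume I := by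
    calc _ = ∫⁻ t in {t | 0 ≤ α * t + β} ∩ f ⁻¹' I, ENNReal.ofReal (f' t) :=
          setLIntegral_congr_fun (hmp.inter hIm) fun t ht => by
            simp only [abs_of_nonneg (hpos t ht.1)]
      _ = volume (f '' ({t | 0 ≤ α * t + β} ∩ f ⁻¹' I)) :=
          lintegral_deriv_eq_volume_image_of_monotoneOn (hmp.inter hIm)
            (fun t _ => (hf t).hasDerivWithinAt) (mono.mono Set.inter_subset_left)
      _ ≤ _ := measure_mono (by rintro _ ⟨t, ht, rfl⟩; exact ht.2)
  have h2 : ∫⁻ t in {t | α * t + β ≤ 0} ∩ f ⁻¹' I, ENNReal.ofReal |f' t| ≤ volume I := by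
    calc _ = ∫⁻ t in {t | α * t + β ≤ 0} ∩ f ⁻¹' I, ENNReal.ofReal (-f' t) :=
          setLIntegral_congr_fun (hmn.inter hIm) fun t ht => by
            simp only [abs_of_nonpos (hneg t ht.1)]
      _ = volume (f '' ({t | α * t + β ≤ 0} ∩ f ⁻¹' I)) :=
          lintegral_deriv_eq_volume_image_of_antitoneOn (hmn.inter hIm)
            (fun t _ => (hf t).hasDerivWithinAt) (anti.mono Set.inter_subset_left)
      _ ≤ _ := measure_mono (by rintro _ ⟨t, ht, rfl⟩; exact ht.2)
  have hsub : f ⁻¹' I ⊆ ({t | 0 ≤ α * t + β} ∩ f ⁻¹' I) ∪ ({t | α * t + β ≤ 0} ∩ f ⁻¹' I) := by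
    intro t ht
    rcases le_total 0 (α * t + β) with h | h
    · exact Or.inl ⟨h, ht⟩
    · exact Or.inr ⟨h, ht⟩
  calc _ ≤ _ := lintegral_mono_set hsub
    _ ≤ _ := lintegral_union_le _ _ _
    _ ≤ volume I + volume I := add_le_add h1 h2
    _ = _ := (two_mul _).symm

theorem hasDerivAt_sqrt_add_sq {a : ℝ} (ha : 0 < a) (p t : ℝ) :
    HasDerivAt (fun t => √(a + (t - p) ^ 2)) ((t - p) / √(a + (t - p) ^ 2)) t := by
  have h : HasDerivAt (fun t => a + (t - p) ^ 2) (2 * (t - p)) t := by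
    have := (((hasDerivAt_id t).sub_const p).pow 2).const_add a
    simpa using this
  convert! h.sqrt (by positivity) using 1
  rw [mul_div_mul_left _ _ two_ne_zero]

theorem lintegral_line_le {a b σ₁ σ₂ : ℝ} (ha : 0 < a) (hb : 0 < b) (hσ₁ : σ₁ ^ 2 = 1)
    (hσ₂ : σ₂ ^ 2 = 1) (p q : ℝ) {I : Set ℝ} (hI : MeasurableSet I) :
    ∫⁻ t in (fun t => σ₁ * √(a + (t - p) ^ 2) + σ₂ * √(b + (t - q) ^ 2)) ⁻¹' I,
      ENNReal.ofReal |σ₁ * ((t - p) / √(a + (t - p) ^ 2)) + σ₂ * ((t - q) / √(b + (t - q) ^ 2))|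
      ≤ 2 * volume I := by
  -- A sign squares to one, so it can be absorbed into the argument `u = σ * (t - p)`.
  have key : ∀ σ t a p : ℝ, σ ^ 2 = 1 →
      σ * ((t - p) / √(a + (t - p) ^ 2)) = σ * (t - p) / √(a + (σ * (t - p)) ^ 2) := by
    intro σ t a p h
    rw [mul_pow, h, one_mul, mul_div_assoc]
  refine lintegral_abs_deriv_preimage_le (α := σ₁ / √a + σ₂ / √b)
    (β := -(σ₁ * p / √a + σ₂ * q / √b)) (fun t =>
      ((hasDerivAt_sqrt_add_sq ha p t).const_mul σ₁).add
        ((hasDerivAt_sqrt_add_sq hb q t).const_mul σ₂)) ?_ ?_ hI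
  · intro t h
    rw [key σ₁ _ _ _ hσ₁, key σ₂ _ _ _ hσ₂]
    refine div_sqrt_add_div_sqrt_nonneg ha hb (h.trans_eq ?_)
    ring
  · intro t h
    -- The nonpositive case follows from the nonnegative one by flipping both signs.
    have := div_sqrt_add_div_sqrt_nonneg (u := -σ₁ * (t - p)) (v := -σ₂ * (t - q)) ha hb
      ((neg_nonneg.2 h).trans_eq (by ring))
    rw [← key (-σ₁) _ _ _ (by simpa using hσ₁), ← key (-σ₂) _ _ _ (by simpa using hσ₂)] at this
    linarith

/-! ### Slicing the phase by coordinate lines in space -/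

theorem norm_toLp_insertNth (i : Fin 3) (t : ℝ) (y : Fin 2 → ℝ) :
    ‖(WithLp.toLp 2 (i.insertNth t y) : Space)‖ = √(∑ j, y j ^ 2 + t ^ 2) := by
  rw [EuclideanSpace.norm_eq, Fin.sum_univ_succAbove _ i]
  simp [add_comm]

theorem sum_sq_pos {y : Fin 2 → ℝ} (hy : y ≠ 0) : 0 < ∑ j, y j ^ 2 := by
  obtain ⟨j, hj⟩ := Function.ne_iff.1 hy
  exact Finset.sum_pos' (fun _ _ => sq_nonneg _)
    ⟨j, Finset.mem_univ _, by have : y j ≠ 0 := hj; positivity⟩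

/-- The phase `±₁|ξ| ±₂|ξ₀ - ξ|`. -/
noncomputable def phase (σ₁ σ₂ : ℝ) (ξ₀ ξ : Space) : ℝ := σ₁ * ‖ξ‖ + σ₂ * ‖ξ₀ - ξ‖

/-- The `i`-th partial derivative of `phase`. -/
noncomputable def phaseDeriv (σ₁ σ₂ : ℝ) (ξ₀ : Space) (i : Fin 3) (ξ : Space) : ℝ :=
  σ₁ * (ξ i / ‖ξ‖) + σ₂ * ((ξ i - ξ₀ i) / ‖ξ₀ - ξ‖)

theorem measurable_phaseDeriv (σ₁ σ₂ : ℝ) (ξ₀ : Space) (i : Fin 3) :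
    Measurable (phaseDeriv σ₁ σ₂ ξ₀ i) := by
  unfold phaseDeriv
  fun_prop

theorem continuous_phase (σ₁ σ₂ : ℝ) (ξ₀ : Space) : Continuous (phase σ₁ σ₂ ξ₀) := by
  unfold phase
  fun_prop

theorem lintegral_space_eq (i : Fin 3) {g : Space → ℝ≥0∞} (hg : Measurable g) :
    ∫⁻ ξ, g ξ = ∫⁻ y : Fin 2 → ℝ, ∫⁻ t : ℝ, g (WithLp.toLp 2 (i.insertNth t y)) := by
  have h1 : MeasurePreserving (fun z : ℝ × (Fin 2 → ℝ) =>
      (WithLp.toLp 2 (i.insertNth z.1 z.2 : Fin 3 → ℝ) : Space)) :=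
    (PiLp.volume_preserving_toLp (Fin 3)).comp
      (volume_preserving_piFinSuccAbove (fun _ => ℝ) i).symm
  rw [← h1.lintegral_comp hg, Measure.volume_eq_prod]
  exact lintegral_prod_symm _ (hg.comp h1.measurable).aemeasurable

theorem norm_sub_toLp_insertNth (ξ₀ : Space) (i : Fin 3) (t : ℝ) (y : Fin 2 → ℝ) :
    ‖ξ₀ - (WithLp.toLp 2 (i.insertNth t y) : Space)‖
      = √(∑ j, (ξ₀ (i.succAbove j) - y j) ^ 2 + (t - ξ₀ i) ^ 2) := by
  rw [EuclideanSpace.norm_eq, Fin.sum_univ_succAbove _ i]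
  simp [add_comm, sub_sq_comm t]

theorem lintegral_phaseDeriv_line_le {σ₁ σ₂ : ℝ} (hσ₁ : σ₁ ^ 2 = 1) (hσ₂ : σ₂ ^ 2 = 1)
    (ξ₀ : Space) (i : Fin 3) {I : Set ℝ} (hI : MeasurableSet I) {y : Fin 2 → ℝ} (hy : y ≠ 0)
    (hy' : y ≠ fun j => ξ₀ (i.succAbove j)) :
    ∫⁻ t in {t | phase σ₁ σ₂ ξ₀ (WithLp.toLp 2 (i.insertNth t y)) ∈ I},
      ENNReal.ofReal |phaseDeriv σ₁ σ₂ ξ₀ i (WithLp.toLp 2 (i.insertNth t y))|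
      ≤ 2 * volume I := by
  have hy1 : (fun j => ξ₀ (i.succAbove j) - y j) ≠ 0 := fun h =>
    hy' (funext fun j => (sub_eq_zero.1 (congrFun h j)).symm)
  have := lintegral_line_le (sum_sq_pos hy) (sum_sq_pos hy1) hσ₁ hσ₂ 0 (ξ₀ i) hI
  simp only [sub_zero] at this
  simp only [phase, phaseDeriv, norm_toLp_insertNth, norm_sub_toLp_insertNth,
    Fin.insertNth_apply_same]
  exact this

theorem abs_apply_sub_le {ξ c : Space} {r : ℝ} (h : ξ ∈ Metric.closedBall c r) (j : Fin 3) :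
    |ξ j - c j| ≤ r :=
  (PiLp.norm_apply_le (ξ - c) j).trans (mem_closedBall_iff_norm.1 h)

/-- Tonelli: each line in direction `i` contributes at most `2 * volume I`, and the lines meeting
the ball are parametrized by a subset of a square of side `2 * r`. -/
theorem lintegral_phaseDeriv_le {σ₁ σ₂ : ℝ} (hσ₁ : σ₁ ^ 2 = 1) (hσ₂ : σ₂ ^ 2 = 1) (ξ₀ c : Space)
    {r : ℝ} (i : Fin 3) {I : Set ℝ} (hI : MeasurableSet I) :
    ∫⁻ ξ in Metric.closedBall c r ∩ phase σ₁ σ₂ ξ₀ ⁻¹' I,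
      ENNReal.ofReal |phaseDeriv σ₁ σ₂ ξ₀ i ξ| ≤ 2 * ENNReal.ofReal (2 * r) ^ 2 * volume I := by
  have hS : MeasurableSet (Metric.closedBall c r ∩ phase σ₁ σ₂ ξ₀ ⁻¹' I) :=
    Metric.isClosed_closedBall.measurableSet.inter ((continuous_phase _ _ _).measurable hI)
  rw [← lintegral_indicator hS, lintegral_space_eq i
    ((measurable_phaseDeriv σ₁ σ₂ ξ₀ i).abs.ennreal_ofReal.indicator hS)]
  set R : Set (Fin 2 → ℝ) :=
    Set.pi Set.univ fun j => Set.Icc (c (i.succAbove j) - r) (c (i.succAbove j) + r)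
  have hR : volume R = ENNReal.ofReal (2 * r) ^ 2 := by
    rw [volume_pi_pi]
    simp only [Real.volume_Icc, Fin.prod_univ_two, sq]
    congr 2 <;> ring
  have hRm : MeasurableSet R := MeasurableSet.univ_pi fun _ => measurableSet_Icc
  -- The lines through the origin and through `ξ₀`, on which a norm fails to be differentiable, form
  -- a null set.
  have hne : ∀ z : Fin 2 → ℝ, ∀ᵐ y : Fin 2 → ℝ, y ≠ z := fun z => by
    simp [ae_iff]
  calc _ ≤ ∫⁻ y, R.indicator (fun _ => 2 * volume I) y := by
        refine lintegral_mono_ae ?_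
        filter_upwards [hne 0, hne fun j => ξ₀ (i.succAbove j)] with y hy0 hy1
        by_cases hyR : y ∈ R
        · rw [Set.indicator_of_mem hyR]
          have hm : MeasurableSet {t : ℝ | phase σ₁ σ₂ ξ₀ (WithLp.toLp 2 (i.insertNth t y)) ∈ I} := by
            refine Measurable.comp (continuous_phase σ₁ σ₂ ξ₀).measurable ?_ hI
            exact (PiLp.continuous_toLp 2 _).measurable.comp
              ((continuous_id.finInsertNth i continuous_const).measurable)
          refine le_trans ?_ (lintegral_phaseDeriv_line_le hσ₁ hσ₂ ξ₀ i hI hy0 hy1)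
          rw [← lintegral_indicator hm]
          refine lintegral_mono fun t => ?_
          by_cases ht : WithLp.toLp 2 (i.insertNth t y) ∈
              Metric.closedBall c r ∩ phase σ₁ σ₂ ξ₀ ⁻¹' I
          · rw [Set.indicator_of_mem ht, Set.indicator_of_mem]
            exact ht.2
          · rw [Set.indicator_of_notMem ht]
            exact zero_le
        · rw [Set.indicator_of_notMem hyR, lintegral_eq_zero_of_ae_eq_zero]
          refine Filter.Eventually.of_forall fun t => Set.indicator_of_notMem ?_ _
          intro ht
          refine hyR fun j _ => ?_
          have h2 := abs_le.1 (abs_apply_sub_le ht.1 (i.succAbove j))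
          simp only [Fin.insertNth_apply_succAbove] at h2
          constructor <;> linarith [h2.1, h2.2]
    _ = _ := by
        rw [lintegral_indicator hRm, lintegral_const, Measure.restrict_apply_univ, hR]
        ring

/-! ### The angle and the gradient of the phase -/

/-- After normalization the right side is a chord of the unit sphere, of length `2 sin(θ/2)`, and
Jordan's inequality bounds the sine below by `2/π` times its argument. -/
theorem theta_le {s₁ s₂ : ℤˣ} {ξ₁ ξ₂ : Space} (h₁ : ξ₁ ≠ 0) (h₂ : ξ₂ ≠ 0) :
    theta s₁ s₂ ξ₁ ξ₂ ≤ Real.pi / 2 * ‖(sgn s₁ / ‖ξ₁‖) • ξ₁ - (sgn s₂ / ‖ξ₂‖) • ξ₂‖ := by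
  have habs : ∀ s : ℤˣ, |sgn s| = 1 := fun s => by
    rcases Int.units_eq_one_or s with rfl | rfl <;> simp [sgn]
  have hn₁ := norm_pos_iff.2 h₁
  have hn₂ := norm_pos_iff.2 h₂
  set x := (sgn s₁ / ‖ξ₁‖) • ξ₁ with hx
  set y := (sgn s₂ / ‖ξ₂‖) • ξ₂ with hy
  have hx1 : ‖x‖ = 1 := by
    rw [hx, norm_smul, norm_div, Real.norm_eq_abs, habs, norm_norm, one_div_mul_cancel hn₁.ne']
  have hy1 : ‖y‖ = 1 := by
    rw [hy, norm_smul, norm_div, Real.norm_eq_abs, habs, norm_norm, one_div_mul_cancel hn₂.ne']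
  have hang : theta s₁ s₂ ξ₁ ξ₂ = InnerProductGeometry.angle x y := by
    have ex : x = ‖ξ₁‖⁻¹ • sgn s₁ • ξ₁ := by rw [hx, smul_smul, div_eq_inv_mul]
    have ey : y = ‖ξ₂‖⁻¹ • sgn s₂ • ξ₂ := by rw [hy, smul_smul, div_eq_inv_mul]
    rw [ex, ey, InnerProductGeometry.angle_smul_left_of_pos _ _ (inv_pos.2 hn₁),
      InnerProductGeometry.angle_smul_right_of_pos _ _ (inv_pos.2 hn₂)]
    rfl
  rw [hang]
  set θ := InnerProductGeometry.angle x y with hθ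
  have h0 : 0 ≤ θ := InnerProductGeometry.angle_nonneg x y
  have hpi : θ ≤ Real.pi := InnerProductGeometry.angle_le_pi x y
  have hsin := Real.mul_le_sin (x := θ / 2) (by positivity) (by linarith)
  have hsin0 : 0 ≤ Real.sin (θ / 2) := Real.sin_nonneg_of_nonneg_of_le_pi (by linarith) (by linarith)
  have hcos : inner ℝ x y = Real.cos θ := by
    rw [hθ, InnerProductGeometry.cos_angle, hx1, hy1]; simp
  have hsq : ‖x - y‖ ^ 2 = (2 * Real.sin (θ / 2)) ^ 2 := by
    rw [norm_sub_sq_real, hx1, hy1, hcos, mul_pow, Real.sin_sq_eq_half_sub]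
    rw [show 2 * (θ / 2) = θ by ring]
    ring
  have heq : ‖x - y‖ = 2 * Real.sin (θ / 2) :=
    (sq_eq_sq₀ (norm_nonneg _) (by positivity)).1 hsq
  rw [heq]
  calc θ = Real.pi / 2 * (2 * (2 / Real.pi * (θ / 2))) := by field_simp
    _ ≤ _ := by gcongr

theorem norm_le_sum_abs (x : Space) : ‖x‖ ≤ ∑ i, |x i| := by
  rw [EuclideanSpace.norm_eq]
  refine Real.sqrt_le_iff.2 ⟨Finset.sum_nonneg fun _ _ => abs_nonneg _, ?_⟩
  exact Finset.sum_sq_le_sq_sum_of_nonneg fun _ _ => abs_nonneg _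

theorem theta_le_sum_phaseDeriv {s₁ s₂ : ℤˣ} {ξ₀ ξ : Space} (h₁ : ξ ≠ 0) (h₂ : ξ₀ - ξ ≠ 0) :
    theta s₁ s₂ ξ (ξ₀ - ξ) ≤ Real.pi / 2 * ∑ i, |phaseDeriv (sgn s₁) (sgn s₂) ξ₀ i ξ| := by
  refine (theta_le h₁ h₂).trans ?_
  gcongr
  refine (norm_le_sum_abs _).trans_eq (Finset.sum_congr rfl fun i _ => ?_)
  simp only [phaseDeriv, PiLp.sub_apply, PiLp.smul_apply, smul_eq_mul]
  congr 1
  ring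

theorem sgn_sq (s : ℤˣ) : sgn s ^ 2 = 1 := by
  rcases Int.units_eq_one_or s with rfl | rfl <;> simp [sgn]

/-- A substitute for the coarea formula: the weight compensates the vanishing of the gradient, and
splitting the gradient into coordinates avoids integrating over level surfaces. -/
theorem lintegral_theta_le (s₁ s₂ : ℤˣ) (ξ₀ c : Space) {r : ℝ} (hr : 0 < r) {I : Set ℝ}
    (hI : MeasurableSet I) :
    ∫⁻ ξ in Metric.closedBall c r ∩ phase (sgn s₁) (sgn s₂) ξ₀ ⁻¹' I,
      ENNReal.ofReal (theta s₁ s₂ ξ (ξ₀ - ξ)) ≤ ENNReal.ofReal (12 * Real.pi * r ^ 2) * volume I := by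
  have hne : ∀ z : Space, ∀ᵐ ξ : Space, ξ ≠ z := fun z => by
    simp [ae_iff]
  calc _ ≤ ∫⁻ ξ in Metric.closedBall c r ∩ phase (sgn s₁) (sgn s₂) ξ₀ ⁻¹' I,
        ENNReal.ofReal (Real.pi / 2) *
          ∑ i, ENNReal.ofReal |phaseDeriv (sgn s₁) (sgn s₂) ξ₀ i ξ| := by
        refine lintegral_mono_ae (ae_restrict_of_ae ?_)
        filter_upwards [hne 0, hne ξ₀] with ξ h0 h1
        rw [← ENNReal.ofReal_sum_of_nonneg fun _ _ => abs_nonneg _,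
          ← ENNReal.ofReal_mul (by positivity)]
        exact ENNReal.ofReal_le_ofReal
          (theta_le_sum_phaseDeriv h0 (sub_ne_zero.2 h1.symm))
    _ = ENNReal.ofReal (Real.pi / 2) * ∑ i,
        ∫⁻ ξ in Metric.closedBall c r ∩ phase (sgn s₁) (sgn s₂) ξ₀ ⁻¹' I,
          ENNReal.ofReal |phaseDeriv (sgn s₁) (sgn s₂) ξ₀ i ξ| := by
        have hm := fun i => (measurable_phaseDeriv (sgn s₁) (sgn s₂) ξ₀ i).abs.ennreal_ofReal
        rw [lintegral_const_mul _ (Finset.measurable_sum _ fun i _ => hm i),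
          lintegral_finsetSum _ fun i _ => hm i]
    _ ≤ ENNReal.ofReal (Real.pi / 2) *
        ∑ _i : Fin 3, 2 * ENNReal.ofReal (2 * r) ^ 2 * volume I := by
        gcongr with i
        exact lintegral_phaseDeriv_le (sgn_sq _) (sgn_sq _) ξ₀ c i hI
    -- The constant is `π/2 · 3 · 2 · (2r)² = 12πr²`.
    _ = _ := by
        rw [Finset.sum_const, Finset.card_univ, Fintype.card_fin, nsmul_eq_mul,
          ← ENNReal.ofReal_pow (by positivity), show (2 : ℝ≥0∞) = ENNReal.ofReal 2 by simp,
          show ((3 : ℕ) : ℝ≥0∞) = ENNReal.ofReal 3 by simp, ← mul_assoc, ← mul_assoc,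
          ← ENNReal.ofReal_mul (by positivity), ← mul_assoc, ← ENNReal.ofReal_mul (by positivity),
          ← ENNReal.ofReal_mul (by positivity)]
        congr 2
        ring

theorem measurable_theta (s₁ s₂ : ℤˣ) : Measurable fun z : Space × Space => theta s₁ s₂ z.1 z.2 := by
  unfold theta InnerProductGeometry.angle
  fun_prop

/-! ### Integrating the angle over the interaction set -/

theorem lintegral_spacetime_eq {g : Spacetime → ℝ≥0∞} (hg : Measurable g) :
    ∫⁻ X, g X = ∫⁻ ξ : Space, ∫⁻ τ : ℝ, g (WithLp.toLp 2 (τ, ξ)) := by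
  have h := WithLp.volume_preserving_toLp ℝ Space
  rw [← h.lintegral_comp hg, Measure.volume_eq_prod]
  exact lintegral_prod_symm _ (hg.comp h.measurable).aemeasurable

theorem Spacetime.measurable_fst : Measurable fun X : Spacetime => X.fst :=
  (WithLp.continuous_fst 2 ℝ Space).measurable

theorem Spacetime.measurable_snd : Measurable fun X : Spacetime => X.snd :=
  (WithLp.continuous_snd 2 ℝ Space).measurable

theorem measurable_comp_snd_sub {k : Space → Space → ℝ}
    (hk : Measurable fun z : Space × Space => k z.1 z.2) (X₀ : Spacetime) :
    Measurable fun X : Spacetime => k X.snd (X₀ - X).snd := by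
  have h1 : Measurable fun X : Spacetime => X₀ - X := by fun_prop
  have h2 : Measurable fun X : Spacetime => (X₀ - X).snd := Spacetime.measurable_snd.comp h1
  exact hk.comp (Spacetime.measurable_snd.prodMk h2)

theorem measurableSet_thickCone (s : ℤˣ) (N L : ℝ) : MeasurableSet (thickCone s N L) := by
  have h1 := Spacetime.measurable_fst
  have h2 := Spacetime.measurable_snd
  exact (measurableSet_lt (f := fun _ : Spacetime => N / 2) (g := fun X => ‖X.snd‖)
    measurable_const h2.norm).inter
      ((measurableSet_le (f := fun X : Spacetime => ‖X.snd‖) h2.norm measurable_const).inter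
      (measurableSet_le (f := fun X : Spacetime => |-X.fst + sgn s * ‖X.snd‖|)
        (h1.neg.add (h2.norm.const_mul _)).abs measurable_const))

/-- Each condition alone confines `τ` to an interval; the shorter one is kept. -/
theorem volume_two_strips_le {L₁ L₂ a b : ℝ} (τ₀ : ℝ) :
    volume {τ : ℝ | |-τ + a| ≤ L₁ ∧ |-(τ₀ - τ) + b| ≤ L₂} ≤ ENNReal.ofReal (2 * min L₁ L₂) := by
  rcases le_total L₁ L₂ with h | h
  · rw [min_eq_left h]
    calc _ ≤ volume (Set.Icc (a - L₁) (a + L₁)) := measure_mono fun τ hτ => by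
          have := abs_le.1 hτ.1
          constructor <;> linarith
      _ = _ := by rw [Real.volume_Icc]; congr 1; ring
  · rw [min_eq_right h]
    calc _ ≤ volume (Set.Icc (τ₀ - b - L₂) (τ₀ - b + L₂)) := measure_mono fun τ hτ => by
          have := abs_le.1 hτ.2
          constructor <;> linarith
      _ = _ := by rw [Real.volume_Icc]; congr 1; ring

/-- The domain of the convolution integral at `X₀` for functions supported in
`thickCone s₁ N₁ L₁ ∩ ballCylinder c r` and `thickCone s₂ N₂ L₂`. -/
def interactionSet (s₁ s₂ : ℤˣ) (N₁ N₂ L₁ L₂ r : ℝ) (c : Space) (X₀ : Spacetime) :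
    Set Spacetime :=
  {X | (X ∈ ballCylinder c r ∧ X ∈ thickCone s₁ N₁ L₁) ∧ X₀ - X ∈ thickCone s₂ N₂ L₂}

theorem measurableSet_interactionSet (s₁ s₂ : ℤˣ) (N₁ N₂ L₁ L₂ r : ℝ) (c : Space)
    (X₀ : Spacetime) : MeasurableSet (interactionSet s₁ s₂ N₁ N₂ L₁ L₂ r c X₀) :=
  ((measurableSet_ballCylinder c r).inter (measurableSet_thickCone s₁ N₁ L₁)).inter
      ((measurable_id.const_sub X₀) (measurableSet_thickCone s₂ N₂ L₂))

/-- Adding the two cone inequalities eliminates `τ`, which puts the phase within `L₁ + L₂` of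
`X₀.fst`. -/
theorem mem_interactionSet {s₁ s₂ : ℤˣ} {N₁ N₂ L₁ L₂ r : ℝ} {c : Space} {X₀ : Spacetime}
    {τ : ℝ} {ξ : Space}
    (h : WithLp.toLp 2 (τ, ξ) ∈ interactionSet s₁ s₂ N₁ N₂ L₁ L₂ r c X₀) :
    ξ ∈ Metric.closedBall c r ∩ phase (sgn s₁) (sgn s₂) X₀.snd ⁻¹'
        Set.Icc (X₀.fst - (L₁ + L₂)) (X₀.fst + (L₁ + L₂)) ∧
      τ ∈ {τ : ℝ | |-τ + sgn s₁ * ‖ξ‖| ≤ L₁ ∧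
        |-(X₀.fst - τ) + sgn s₂ * ‖X₀.snd - ξ‖| ≤ L₂} := by
  obtain ⟨⟨hB, -, -, h1⟩, -, -, h2⟩ := h
  refine ⟨⟨hB, ?_⟩, h1, h2⟩
  have h1 : |-τ + sgn s₁ * ‖ξ‖| ≤ L₁ := h1
  have h2 : |-(X₀.fst - τ) + sgn s₂ * ‖X₀.snd - ξ‖| ≤ L₂ := h2
  rw [abs_le] at h1 h2
  simp only [Set.mem_preimage, phase, Set.mem_Icc]
  constructor <;> linarith [h1.1, h1.2, h2.1, h2.2]

theorem lintegral_slice_interactionSet_le (s₁ s₂ : ℤˣ) (N₁ N₂ L₁ L₂ r : ℝ) (c : Space)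
    (X₀ : Spacetime) (ξ : Space) (k : Space → Space → ℝ≥0∞) :
    ∫⁻ τ : ℝ, (interactionSet s₁ s₂ N₁ N₂ L₁ L₂ r c X₀).indicator
        (fun X => k X.snd (X₀ - X).snd) (WithLp.toLp 2 (τ, ξ)) ≤
      (Metric.closedBall c r ∩ phase (sgn s₁) (sgn s₂) X₀.snd ⁻¹'
        Set.Icc (X₀.fst - (L₁ + L₂)) (X₀.fst + (L₁ + L₂))).indicator
          (fun ξ => k ξ (X₀.snd - ξ)) ξ * ENNReal.ofReal (2 * min L₁ L₂) := by
  by_cases hξ : ξ ∈ Metric.closedBall c r ∩ phase (sgn s₁) (sgn s₂) X₀.snd ⁻¹'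
        Set.Icc (X₀.fst - (L₁ + L₂)) (X₀.fst + (L₁ + L₂))
  · rw [Set.indicator_of_mem hξ]
    set J := {τ : ℝ | |-τ + sgn s₁ * ‖ξ‖| ≤ L₁ ∧ |-(X₀.fst - τ) + sgn s₂ * ‖X₀.snd - ξ‖| ≤ L₂}
    calc _ ≤ ∫⁻ τ, J.indicator (fun _ => k ξ (X₀.snd - ξ)) τ := by
          refine lintegral_mono fun τ => ?_
          by_cases hτ : WithLp.toLp 2 (τ, ξ) ∈ interactionSet s₁ s₂ N₁ N₂ L₁ L₂ r c X₀
          · rw [Set.indicator_of_mem hτ, Set.indicator_of_mem (mem_interactionSet hτ).2]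
            exact le_rfl
          · rw [Set.indicator_of_notMem hτ]
            exact zero_le
      _ ≤ k ξ (X₀.snd - ξ) * volume J := lintegral_indicator_const_le _ _
      _ ≤ _ := by
        gcongr
        exact volume_two_strips_le _
  · rw [lintegral_eq_zero_of_ae_eq_zero]
    · exact zero_le
    · exact Filter.Eventually.of_forall fun τ =>
        Set.indicator_of_notMem (fun h => hξ (mem_interactionSet h).1) _

theorem lintegral_theta_thickCone_le (s₁ s₂ : ℤˣ) (N₁ N₂ : ℝ) {L₁ L₂ r : ℝ} (c : Space)
    (hL₁ : 0 < L₁) (hL₂ : 0 < L₂) (hr : 0 < r) (X₀ : Spacetime) :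
    ∫⁻ X in interactionSet s₁ s₂ N₁ N₂ L₁ L₂ r c X₀,
      ENNReal.ofReal (theta s₁ s₂ X.snd (X₀ - X).snd)
      ≤ ENNReal.ofReal (96 * Real.pi * (r ^ 2 * L₁ * L₂)) := by
  have hth : Measurable fun X : Spacetime => theta s₁ s₂ X.snd (X₀ - X).snd :=
    measurable_comp_snd_sub (measurable_theta s₁ s₂) X₀
  have hS := measurableSet_interactionSet s₁ s₂ N₁ N₂ L₁ L₂ r c X₀
  have hT : MeasurableSet (Metric.closedBall c r ∩ phase (sgn s₁) (sgn s₂) X₀.snd ⁻¹'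
      Set.Icc (X₀.fst - (L₁ + L₂)) (X₀.fst + (L₁ + L₂))) :=
    Metric.isClosed_closedBall.measurableSet.inter
      ((continuous_phase _ _ _).measurable measurableSet_Icc)
  -- The sum is at most twice the maximum, and maximum times minimum is `L₁ * L₂`.
  have hnum : 12 * Real.pi * r ^ 2 * (2 * (L₁ + L₂)) * (2 * min L₁ L₂)
      ≤ 96 * Real.pi * (r ^ 2 * L₁ * L₂) := by
    have h : (L₁ + L₂) * min L₁ L₂ ≤ 2 * (L₁ * L₂) := by
      rcases le_total L₁ L₂ with h | h
      · rw [min_eq_left h]; nlinarith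
      · rw [min_eq_right h]; nlinarith
    have := mul_le_mul_of_nonneg_left h (by positivity : 0 ≤ 48 * Real.pi * r ^ 2)
    linarith
  have hvol : volume (Set.Icc (X₀.fst - (L₁ + L₂)) (X₀.fst + (L₁ + L₂)))
      = ENNReal.ofReal (2 * (L₁ + L₂)) := by
    rw [Real.volume_Icc]; congr 1; ring
  calc _ = ∫⁻ X, (interactionSet s₁ s₂ N₁ N₂ L₁ L₂ r c X₀).indicator
          (fun X => ENNReal.ofReal (theta s₁ s₂ X.snd (X₀ - X).snd)) X :=
        (lintegral_indicator hS _).symm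
    _ = ∫⁻ ξ : Space, ∫⁻ τ : ℝ, (interactionSet s₁ s₂ N₁ N₂ L₁ L₂ r c X₀).indicator
          (fun X => ENNReal.ofReal (theta s₁ s₂ X.snd (X₀ - X).snd)) (WithLp.toLp 2 (τ, ξ)) :=
        lintegral_spacetime_eq (hth.ennreal_ofReal.indicator hS)
    _ ≤ ∫⁻ ξ, (Metric.closedBall c r ∩ phase (sgn s₁) (sgn s₂) X₀.snd ⁻¹'
          Set.Icc (X₀.fst - (L₁ + L₂)) (X₀.fst + (L₁ + L₂))).indicator
            (fun ξ => ENNReal.ofReal (theta s₁ s₂ ξ (X₀.snd - ξ))) ξ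
          * ENNReal.ofReal (2 * min L₁ L₂) :=
        lintegral_mono fun ξ => lintegral_slice_interactionSet_le s₁ s₂ N₁ N₂ L₁ L₂ r c X₀ ξ
          fun ξ₁ ξ₂ => ENNReal.ofReal (theta s₁ s₂ ξ₁ ξ₂)
    _ = (∫⁻ ξ in Metric.closedBall c r ∩ phase (sgn s₁) (sgn s₂) X₀.snd ⁻¹'
          Set.Icc (X₀.fst - (L₁ + L₂)) (X₀.fst + (L₁ + L₂)),
            ENNReal.ofReal (theta s₁ s₂ ξ (X₀.snd - ξ))) * ENNReal.ofReal (2 * min L₁ L₂) := by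
        rw [lintegral_mul_const' _ _ ENNReal.ofReal_ne_top, lintegral_indicator hT]
    _ ≤ (ENNReal.ofReal (12 * Real.pi * r ^ 2) * ENNReal.ofReal (2 * (L₁ + L₂)))
          * ENNReal.ofReal (2 * min L₁ L₂) := by
        rw [← hvol]
        gcongr
        exact lintegral_theta_le s₁ s₂ X₀.snd c hr measurableSet_Icc
    _ ≤ _ := by
        rw [← ENNReal.ofReal_mul (by positivity), ← ENNReal.ofReal_mul (by positivity)]
        exact ENNReal.ofReal_le_ofReal hnum

/-! ### Plancherel and the weighted convolution bound -/

theorem sq_lintegral_mul_le {α : Type*} [MeasurableSpace α] {μ : Measure α} {f g : α → ℝ≥0∞}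
    (hf : AEMeasurable f μ) (hg : AEMeasurable g μ) :
    (∫⁻ x, f x * g x ∂μ) ^ 2 ≤ (∫⁻ x, f x ^ 2 ∂μ) * ∫⁻ x, g x ^ 2 ∂μ := by
  have h := ENNReal.lintegral_mul_le_Lp_mul_Lq μ Real.HolderConjugate.two_two hf hg
  simp only [Pi.mul_apply, ENNReal.rpow_two] at h
  calc _ ≤ _ := pow_le_pow_left' h 2
    _ = _ := by
      rw [mul_pow, ← ENNReal.rpow_mul_natCast, ← ENNReal.rpow_mul_natCast]
      norm_num

theorem lintegral_comp_smul_spacetime {f : Spacetime → ℝ≥0∞} (hf : Measurable f) {c : ℝ} (hc : 0 < c) :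
    ∫⁻ X, f (c • X) = ENNReal.ofReal ((c ^ 4)⁻¹) * ∫⁻ X, f X := by
  have h4 : Module.finrank ℝ Spacetime = 4 := by
    rw [(WithLp.linearEquiv 2 ℝ (ℝ × Space)).finrank_eq, Module.finrank_prod]
    simp
  rw [← lintegral_map hf (measurable_const_smul c), Measure.map_addHaar_smul _ hc.ne',
    lintegral_smul_measure, h4, abs_of_pos (by positivity), smul_eq_mul]

theorem sq_enorm_L2 (u : L2Spacetime) : ‖u‖ₑ ^ 2 = ∫⁻ X, ‖u X‖ₑ ^ 2 := by
  have h := eLpNorm_nnreal_pow_eq_lintegral (f := u) (μ := volume) (p := 2) two_ne_zero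
  rw [Lp.enorm_def]
  simpa using h

theorem enorm_fourier (u : L2Spacetime) : ‖(𝓕 u : L2Spacetime)‖ₑ = ‖u‖ₑ := by
  rw [← ofReal_norm, ← ofReal_norm, Lp.norm_fourier_eq]

theorem stronglyMeasurable_hat (u : L2Spacetime) : StronglyMeasurable (hat u) :=
  (Lp.stronglyMeasurable _).comp_measurable (measurable_const_smul _)

/-- Plancherel; the factor is the Jacobian of dilation by `2π` in dimension four. -/
theorem lintegral_sq_hat (u : L2Spacetime) :
    ∫⁻ X, ‖hat u X‖ₑ ^ 2 = ENNReal.ofReal ((2 * Real.pi) ^ 4) * ‖u‖ₑ ^ 2 := by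
  have hpi : 0 < (2 * Real.pi)⁻¹ := by positivity
  have hm : Measurable fun X => ‖(𝓕 u : L2Spacetime) X‖ₑ ^ 2 :=
    (Lp.stronglyMeasurable _).measurable.enorm.pow_const 2
  rw [← enorm_fourier, sq_enorm_L2]
  convert! lintegral_comp_smul_spacetime hm hpi using 3
  rw [inv_pow, inv_inv]

/-- A function is the (rescaled) Fourier transform of an `L²` function as soon as it is square
integrable. -/
theorem exists_hat_eq {F : Spacetime → ℂ} (hF : StronglyMeasurable F)
    (hfin : ∫⁻ X, ‖F X‖ₑ ^ 2 ≠ ∞) :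
    ∃ w : L2Spacetime, (∀ᵐ X, hat w X = F X) ∧
      ENNReal.ofReal ((2 * Real.pi) ^ 4) * ‖w‖ₑ ^ 2 = ∫⁻ X, ‖F X‖ₑ ^ 2 := by
  have hpi : 0 < 2 * Real.pi := by positivity
  have hm : Measurable fun X => ‖F X‖ₑ ^ 2 := hF.measurable.enorm.pow_const 2
  have hW : MemLp (fun Y => F ((2 * Real.pi) • Y)) 2 (volume : Measure Spacetime) := by
    refine ⟨(hF.comp_measurable (measurable_const_smul _)).aestronglyMeasurable, ?_⟩
    have h := eLpNorm_nnreal_pow_eq_lintegral (f := fun Y => F ((2 * Real.pi) • Y))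
      (μ := (volume : Measure Spacetime)) (p := 2) two_ne_zero
    simp only [NNReal.coe_ofNat, ENNReal.rpow_two, ENNReal.coe_ofNat] at h
    rw [lintegral_comp_smul_spacetime hm hpi] at h
    refine lt_top_iff_ne_top.2 fun htop => ?_
    rw [htop] at h
    exact ENNReal.mul_ne_top ENNReal.ofReal_ne_top hfin (by simpa using h.symm)
  have hw : ∀ᵐ X, hat (𝓕⁻ (hW.toLp _) : L2Spacetime) X = F X := by
    have h1 : ∀ᵐ Y, (𝓕 (𝓕⁻ (hW.toLp _) : L2Spacetime) : L2Spacetime) Y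
        = F ((2 * Real.pi) • Y) := by
      rw [fourier_fourierInv_eq]
      exact hW.coeFn_toLp
    filter_upwards [ae_dilate h1 (inv_ne_zero hpi.ne')] with X hX
    rw [hat, hX, smul_inv_smul₀ hpi.ne']
  refine ⟨_, hw, ?_⟩
  rw [← lintegral_sq_hat]
  exact lintegral_congr_ae (hw.mono fun X hX => by simp only [hX])

theorem enorm_fourierRestrict_le (A : Set Spacetime) (hA : MeasurableSet A) (u : L2Spacetime) :
    ‖fourierRestrict A hA u‖ₑ ≤ ‖u‖ₑ := by
  rw [← enorm_fourier, fourierRestrict, fourier_fourierInv_eq, Lp.enorm_toLp, ← enorm_fourier u,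
    Lp.enorm_def]
  exact eLpNorm_indicator_le _

theorem lintegral_lintegral_mul_sub {G : Type*} [NormedAddCommGroup G] [MeasurableSpace G]
    [BorelSpace G] [SecondCountableTopology G] {μ : Measure G} [SFinite μ] [μ.IsAddLeftInvariant]
    {f g : G → ℝ≥0∞} (hf : Measurable f) (hg : Measurable g) :
    ∫⁻ x, ∫⁻ y, f y * g (x - y) ∂μ ∂μ = (∫⁻ y, f y ∂μ) * ∫⁻ y, g y ∂μ := by
  rw [lintegral_lintegral_swap (by fun_prop), ← lintegral_mul_const _ hf]
  refine lintegral_congr fun y => ?_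
  rw [lintegral_const_mul _ (by fun_prop), lintegral_sub_right_eq_self]

/-- The Cauchy-Schwarz estimate for a bilinear convolution with a weight `m`, at a point `x`. -/
theorem sq_lintegral_enorm_bilinear_le {G : Type*} [NormedAddCommGroup G] [MeasurableSpace G]
    [BorelSpace G] {μ : Measure G} {m : G → ℝ} {h₁ h₂ : G → ℂ} (x : G) (hm : Measurable m)
    (hh₁ : Measurable h₁) (hh₂ : Measurable h₂) {S : Set G} (hS : MeasurableSet S)
    (hsupp : ∀ᵐ y ∂μ, y ∉ S → h₁ y * h₂ (x - y) = 0) :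
    (∫⁻ y, ‖(m y : ℂ) * h₁ y * h₂ (x - y)‖ₑ ∂μ) ^ 2 ≤
      (∫⁻ y in S, ENNReal.ofReal (m y ^ 2) ∂μ) *
        ∫⁻ y, ‖h₁ y‖ₑ ^ 2 * ‖h₂ (x - y)‖ₑ ^ 2 ∂μ := by
  calc _ = (∫⁻ y, S.indicator (fun y => ‖m y‖ₑ) y * (‖h₁ y‖ₑ * ‖h₂ (x - y)‖ₑ) ∂μ) ^ 2 := by
        congr 1
        refine lintegral_congr_ae (hsupp.mono fun y hy => ?_)
        by_cases hyS : y ∈ S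
        · simp only [Set.indicator_of_mem hyS, enorm_mul, mul_assoc]
          congr 1
          rw [← ofReal_norm, ← ofReal_norm, Complex.norm_real]
        · simp only [Set.indicator_of_notMem hyS, mul_assoc, hy hyS, mul_zero, enorm_zero, zero_mul]
    _ ≤ (∫⁻ y, S.indicator (fun y => ‖m y‖ₑ) y ^ 2 ∂μ) *
        ∫⁻ y, (‖h₁ y‖ₑ * ‖h₂ (x - y)‖ₑ) ^ 2 ∂μ :=
        sq_lintegral_mul_le (hm.enorm.indicator hS).aemeasurable (by fun_prop)
    _ = _ := by
        simp only [mul_pow]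
        congr 1
        rw [← lintegral_indicator hS]
        refine lintegral_congr fun y => ?_
        by_cases hyS : y ∈ S
        · rw [Set.indicator_of_mem hyS, Set.indicator_of_mem hyS, ← ofReal_norm,
            ← ENNReal.ofReal_pow (norm_nonneg _), Real.norm_eq_abs, sq_abs]
        · simp [Set.indicator_of_notMem hyS]

/-- The pointwise Cauchy-Schwarz bound is `M` times the convolution of `|û₁|²` and `|û₂|²`, whose
integral is the product of the two integrals. This gives both absolute convergence for almost every
`X₀` and square integrability of the output. -/
theorem exists_isBilinear {m : Space → Space → ℝ}
    (hm : Measurable fun z : Space × Space => m z.1 z.2) (u₁ u₂ : L2Spacetime)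
    {S : Spacetime → Set Spacetime} (hS : ∀ X₀, MeasurableSet (S X₀))
    (hsupp : ∀ X₀, ∀ᵐ X, X ∉ S X₀ → hat u₁ X * hat u₂ (X₀ - X) = 0) {M : ℝ}
    (hM : ∀ X₀, ∫⁻ X in S X₀, ENNReal.ofReal (m X.snd (X₀ - X).snd ^ 2) ≤ ENNReal.ofReal M) :
    ∃ w, IsBilinear m u₁ u₂ w ∧
      ‖w‖ₑ ^ 2 ≤ ENNReal.ofReal ((2 * Real.pi) ^ 4 * M) * (‖u₁‖ₑ ^ 2 * ‖u₂‖ₑ ^ 2) := by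
  have hh₁ : Measurable (hat u₁) := (stronglyMeasurable_hat u₁).measurable
  have hh₂ : Measurable (hat u₂) := (stronglyMeasurable_hat u₂).measurable
  set D := ENNReal.ofReal ((2 * Real.pi) ^ 4) with hD
  have hD0 : D ≠ 0 := by rw [hD]; simp; positivity
  have hDtop : D ≠ ∞ := ENNReal.ofReal_ne_top
  set H : Spacetime → ℝ≥0∞ := fun X₀ => ∫⁻ X, ‖hat u₁ X‖ₑ ^ 2 * ‖hat u₂ (X₀ - X)‖ₑ ^ 2 with hH
  have hHint : ∫⁻ X₀, H X₀ = (D * ‖u₁‖ₑ ^ 2) * (D * ‖u₂‖ₑ ^ 2) := by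
    rw [hD, ← lintegral_sq_hat, ← lintegral_sq_hat]
    exact lintegral_lintegral_mul_sub (hh₁.enorm.pow_const 2) (hh₂.enorm.pow_const 2)
  have hHm : Measurable H := by
    refine Measurable.lintegral_prod_right ?_
    fun_prop
  have hHtop : ∫⁻ X₀, H X₀ ≠ ∞ := by
    rw [hHint]
    finiteness
  set G : Spacetime → Spacetime → ℂ := fun X₀ X =>
    (m X.snd (X₀ - X).snd : ℂ) * hat u₁ X * hat u₂ (X₀ - X) with hG
  have hGm : Measurable fun z : Spacetime × Spacetime => G z.1 z.2 := by
    have h1 : Measurable fun z : Spacetime × Spacetime => z.2.snd :=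
      Spacetime.measurable_snd.comp measurable_snd
    have h2 : Measurable fun z : Spacetime × Spacetime => z.1 - z.2 :=
      measurable_fst.sub measurable_snd
    have h3 : Measurable fun z : Spacetime × Spacetime => (z.1 - z.2).snd :=
      Spacetime.measurable_snd.comp h2
    exact ((Complex.measurable_ofReal.comp (hm.comp (h1.prodMk h3))).mul
      (hh₁.comp measurable_snd)).mul (hh₂.comp h2)
  have hGle : ∀ X₀, (∫⁻ X, ‖G X₀ X‖ₑ) ^ 2 ≤ ENNReal.ofReal M * H X₀ := fun X₀ =>
    (sq_lintegral_enorm_bilinear_le X₀ (measurable_comp_snd_sub hm X₀) hh₁ hh₂ (hS X₀)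
      (hsupp X₀)).trans (by gcongr; exact hM X₀)
  have hGi : ∀ᵐ X₀, Integrable (G X₀) := by
    filter_upwards [ae_lt_top hHm hHtop] with X₀ hX₀
    refine ⟨(hGm.comp measurable_prodMk_left).aestronglyMeasurable, ?_⟩
    have := (hGle X₀).trans_lt (ENNReal.mul_lt_top ENNReal.ofReal_lt_top hX₀)
    refine lt_top_iff_ne_top.2 fun htop => ?_
    rw [htop] at this
    simp at this
  have hFle : ∫⁻ X₀, ‖∫ X, G X₀ X‖ₑ ^ 2 ≤ ENNReal.ofReal M * ((D * ‖u₁‖ₑ ^ 2) * (D * ‖u₂‖ₑ ^ 2)) := by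
    rw [← hHint, ← lintegral_const_mul _ hHm]
    refine lintegral_mono fun X₀ => le_trans ?_ (hGle X₀)
    gcongr
    exact enorm_integral_le_lintegral_enorm _
  have hFm : StronglyMeasurable fun X₀ => ∫ X, G X₀ X := hGm.stronglyMeasurable.integral_prod_right
  obtain ⟨w, hw, hnorm⟩ := exists_hat_eq hFm (hFle.trans_lt (by finiteness)).ne
  refine ⟨w, by filter_upwards [hGi, hw] with X₀ h1 h2 using ⟨h1, h2⟩, ?_⟩
  rw [← hnorm] at hFle
  -- Plancherel yields one factor `D` for `w` and two for the inputs; one cancels.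
  rw [ENNReal.ofReal_mul (by positivity), ← hD, ← ENNReal.mul_le_mul_iff_right hD0 hDtop]
  exact hFle.trans_eq (by ring)

/-! ### The bilinear estimate -/

theorem theoremN :
    ∃ C : ℝ, 0 < C ∧
      ∀ (s₁ s₂ : ℤˣ) (N₁ N₂ L₁ L₂ r : ℝ) (c : Space) (u₁ u₂ : L2Spacetime),
        0 < N₁ → 0 < N₂ → 0 < L₁ → 0 < L₂ → 0 < r →
        FourierSupportedIn u₁ (thickCone s₁ N₁ L₁) →
        FourierSupportedIn u₂ (thickCone s₂ N₂ L₂) →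
        ∃ w : L2Spacetime,
          IsBilinear (fun ξ₁ ξ₂ => Real.sqrt (theta s₁ s₂ ξ₁ ξ₂))
            (fourierRestrict (ballCylinder c r) (measurableSet_ballCylinder c r) u₁) u₂ w ∧
          ‖w‖ ≤ C * Real.sqrt (r ^ 2 * L₁ * L₂) * ‖u₁‖ * ‖u₂‖ := by
  refine ⟨√((2 * Real.pi) ^ 4 * (96 * Real.pi)), by positivity, ?_⟩
  intro s₁ s₂ N₁ N₂ L₁ L₂ r c u₁ u₂ _ _ hL₁ hL₂ hr hu₁ hu₂
  have hsupp : ∀ X₀, ∀ᵐ X, X ∉ interactionSet s₁ s₂ N₁ N₂ L₁ L₂ r c X₀ →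
      hat (fourierRestrict (ballCylinder c r) (measurableSet_ballCylinder c r) u₁) X
        * hat u₂ (X₀ - X) = 0 := by
    intro X₀
    -- The reflection `X ↦ X₀ - X` pulls null sets back to null sets.
    have h2 : ∀ᵐ X, X₀ - X ∉ thickCone s₂ N₂ L₂ → hat u₂ (X₀ - X) = 0 :=
      (quasiMeasurePreserving_sub_left_of_right_invariant volume X₀).ae hu₂
    filter_upwards [hu₁, h2, hat_fourierRestrict _ (measurableSet_ballCylinder c r) u₁]
      with X h1 h2 h3 hX
    rw [h3]
    by_cases hB : X ∈ ballCylinder c r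
    · rw [Set.indicator_of_mem hB]
      by_cases hK : X ∈ thickCone s₁ N₁ L₁
      · rw [h2 fun h => hX ⟨⟨hB, hK⟩, h⟩, mul_zero]
      · rw [h1 hK, zero_mul]
    · rw [Set.indicator_of_notMem hB, zero_mul]
  have hM : ∀ X₀ : Spacetime, ∫⁻ X in interactionSet s₁ s₂ N₁ N₂ L₁ L₂ r c X₀,
      ENNReal.ofReal (√(theta s₁ s₂ X.snd (X₀ - X).snd) ^ 2)
        ≤ ENNReal.ofReal (96 * Real.pi * (r ^ 2 * L₁ * L₂)) := by
    intro X₀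
    refine le_trans (le_of_eq (lintegral_congr fun X => ?_))
      (lintegral_theta_thickCone_le s₁ s₂ N₁ N₂ c hL₁ hL₂ hr X₀)
    rw [Real.sq_sqrt (show 0 ≤ theta s₁ s₂ _ _ from InnerProductGeometry.angle_nonneg _ _)]
  obtain ⟨w, hw, hle⟩ := exists_isBilinear (m := fun ξ₁ ξ₂ => √(theta s₁ s₂ ξ₁ ξ₂))
    (measurable_theta s₁ s₂).sqrt _ u₂
    (measurableSet_interactionSet s₁ s₂ N₁ N₂ L₁ L₂ r c) hsupp hM
  refine ⟨w, hw, ?_⟩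
  have hle' : ‖w‖ₑ ^ 2 ≤ ENNReal.ofReal ((2 * Real.pi) ^ 4 * (96 * Real.pi * (r ^ 2 * L₁ * L₂)))
      * (‖u₁‖ₑ ^ 2 * ‖u₂‖ₑ ^ 2) :=
    hle.trans (by gcongr; exact enorm_fourierRestrict_le _ _ _)
  simp only [← ofReal_norm] at hle'
  rw [← ENNReal.ofReal_pow (norm_nonneg _), ← ENNReal.ofReal_pow (norm_nonneg _),
    ← ENNReal.ofReal_pow (norm_nonneg _), ← ENNReal.ofReal_mul (by positivity),
    ← ENNReal.ofReal_mul (by positivity), ENNReal.ofReal_le_ofReal_iff (by positivity)] at hle'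
  refine (sq_le_sq₀ (norm_nonneg _) (by positivity)).1 (hle'.trans_eq ?_)
  rw [mul_pow _ ‖u₂‖, mul_pow _ ‖u₁‖, mul_pow (√_), Real.sq_sqrt (by positivity), Real.sq_sqrt (by positivity)]
  ring
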